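/- **Setting.** For each $N$ let $U_N=\{1,\dots,N\}$, and let $A\subset U_N$ be a random sample drawn by rejective (conditional Poisson) sampling of fixed size $n=n_N$: there are weights $\omega_i=\omega_{i,N}>0$ with $$\mathbb P(A=s)=\frac{\prod_{i\in s}\omega_i}{\sum_{t\subset U_N,\ |t|=n}\prod_{j\in t}\omega_j}\qquad\text{for all } s\subset U_N,\ |s|=n .$$ Write $I_i=\mathbf 1(i\in A)$ and $\pi_i=\mathbb P(I_i=1)$. Independently of $A$, let $\kappa=(\kappa_i)_{i\in U_N}$ be (random or nonrandom) fold labels in $\{1,\dots,K\}$, $K=K_N$, let $U_k=\{i\in U_N:\kappa_i=k\}$ and $N_k=|U_k|$ be the folds and their sizes, and let $$\mathcal G_k=\sigma\big(\kappa,\{I_j:j\in U_N\setminus U_k\}\big).$$ For a $\mathcal G_k$-measurable real array $a=(a_i)_{i\in U_k}$ put $D_k=D_k(a)=N_k^{-1}\sum_{i\in U_k}(I_i/\pi_i-1)a_i$ (with $D_k=0$ and $N_k^{-1}\sum_{i\in U_k}a_i^2=0$ if $U_k=\emptyset$). **Assumptions.** There are constants $0<\pi_{\min}\le\pi_{\max}<1$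 with $\pi_{\min}\le\pi_i\le\pi_{\max}$ for all $i\in U_N$ and all sufficiently large $N$, and $n/N\to f\in(0,1)$ as $N\to\infty$. **Proposition 3.** (i) Fix a fold $k$ (for each $N$, an index $k=k_N\in\{1,\dots,K_N\}$) that is balanced: for some constants $0<c<C<\infty$, $\mathbb P(cN\le N_k\le CN)\to1$ (for nonrandom folds: $cN\le N_k\le CN$ for all large $N$). Then for every $\eta>0$ there are $C_\eta<\infty$ and $N_\eta$ such that for all $N\ge N_\eta$ and every $\mathcal G_k$-measurable array $a$, $$\mathbb P\Big(\mathbb E\big(D_k^2\mid\mathcal G_k\big)\le\frac{C_\eta}{n}\cdot\frac1{N_k}\sum_{i\in U_k}a_i^2\Big)\ge1-\eta .$$ (ii) If all folds are balanced, that is, $\mathbb P(cN\le N_k\le CN\text{ for all }k\le K)\to1$ for some constants $0<c<C<\infty$, then the fold-wise conditional fluctuation bound (A2$^*$) holds: for every $0<\eta<1$ there are $C_\eta<\infty$ and $N_\eta$ such that for every $N\ge N_\eta$ there is an event $E$ with $\mathbb P(E)\ge1-\eta$ on which, for each $k=1,\dots,K$ and each $\mathcal G_k$-measurable array $a$, almost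 surely $$\mathbb E\big(D_k(a)^2\mid\mathcal G_k\big)\le\frac{C_\eta}{n}\cdot\frac1{N_k}\sum_{i\in U_k}a_i^2 .$$ -/

import Mathlib

open MeasureTheory ProbabilityTheory Filter Topology

noncomputable section

namespace SurveySampling

section Single

variable {Ω : Type*} [MeasurableSpace Ω] {N K : ℕ}

/-- The sample membership indicator `I_i`. -/
def incl (A : Ω → Finset (Fin N)) (i : Fin N) (ω : Ω) : ℝ :=
  if i ∈ A ω then 1 else 0

/-- The first-order inclusion probability `π_i = P(I_i = 1)`. -/
def inclProb (P : Measure Ω) (A : Ω → Finset (Fin N)) (i : Fin N) : ℝ :=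
  P.real {ω | i ∈ A ω}

/-- The normalizing constant `Z_n`: the sum over all `t` with `|t| = n` of `∏_{j ∈ t} w_j`. -/
def rejectiveNorm (n : ℕ) (w : Fin N → ℝ) : ℝ :=
  ∑ t ∈ (Finset.univ : Finset (Fin N)).powersetCard n, ∏ j ∈ t, w j

/-- Under `P` the random sample `A` is a rejective (conditional Poisson) sample of fixed size `n`
with odds weights `w`. -/
structure IsRejective (P : Measure Ω) (A : Ω → Finset (Fin N)) (n : ℕ) (w : Fin N → ℝ) :
    Prop where
  weight_pos : ∀ i, 0 < w i
  size : ∀ᵐ ω ∂P, (A ω).card = n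
  law : ∀ s : Finset (Fin N), s.card = n →
    P.real {ω | A ω = s} = (∏ i ∈ s, w i) / rejectiveNorm n w

/-- The fold `U_k = {i : κ_i = k}`. -/
def fold (κ : Ω → Fin N → Fin K) (k : Fin K) (ω : Ω) : Finset (Fin N) :=
  Finset.univ.filter fun i => κ ω i = k

/-- The training sigma-field `σ(κ, {I_j : j ∉ U_k})`. The out-of-fold indicators
are recorded as the set `A \ U_k`, which, jointly with `κ`, carries the same information. -/
@[reducible]
def trainField (A : Ω → Finset (Fin N)) (κ : Ω → Fin N → Fin K) (k : Fin K) :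
    MeasurableSpace Ω :=
  MeasurableSpace.comap (fun ω => (κ ω, A ω \ fold κ k ω)) inferInstance

/-- `D_k = N_k⁻¹ ∑_{i ∈ U_k} (I_i / π_i - 1) a_i`. -/
def fluct (P : Measure Ω) (A : Ω → Finset (Fin N)) (κ : Ω → Fin N → Fin K) (k : Fin K)
    (a : Fin N → Ω → ℝ) (ω : Ω) : ℝ :=
  ((fold κ k ω).card : ℝ)⁻¹ *
    ∑ i ∈ fold κ k ω, (incl A i ω / inclProb P A i - 1) * a i ω

/-- `N_k⁻¹ ∑_{i ∈ U_k} a_i²`. -/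
def foldMeanSq (κ : Ω → Fin N → Fin K) (k : Fin K) (a : Fin N → Ω → ℝ) (ω : Ω) : ℝ :=
  ((fold κ k ω).card : ℝ)⁻¹ * ∑ i ∈ fold κ k ω, a i ω ^ 2

end Single

section Sequence

variable {Ω : ℕ → Type*} [∀ N, MeasurableSpace (Ω N)] {K : ℕ → ℕ}

/-- The fold `k` is balanced: `c N ≤ N_k ≤ C N` with probability tending to one. For nonrandom
folds this says that these inequalities hold for all large `N`. -/
def BalancedFold (P : ∀ N, Measure (Ω N)) (κ : ∀ N, Ω N → Fin N → Fin (K N))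
    (k : ∀ N, Fin (K N)) : Prop :=
  ∃ c C : ℝ, 0 < c ∧ c < C ∧
    Tendsto (fun N : ℕ => (P N).real
      {ω | c * N ≤ ((fold (κ N) (k N) ω).card : ℝ) ∧ ((fold (κ N) (k N) ω).card : ℝ) ≤ C * N})
      atTop (𝓝 1)

/-- All folds are simultaneously balanced. -/
def BalancedFolds (P : ∀ N, Measure (Ω N)) (κ : ∀ N, Ω N → Fin N → Fin (K N)) : Prop :=
  ∃ c C : ℝ, 0 < c ∧ c < C ∧
    Tendsto (fun N : ℕ => (P N).real
      {ω | ∀ k : Fin (K N),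
        c * N ≤ ((fold (κ N) k ω).card : ℝ) ∧ ((fold (κ N) k ω).card : ℝ) ≤ C * N})
      atTop (𝓝 1)

/-- The fold-wise conditional fluctuation bound. The event `E` is common to all folds and all
arrays. -/
def FoldwiseFluctuationBound (P : ∀ N, Measure (Ω N)) (A : ∀ N, Ω N → Finset (Fin N))
    (κ : ∀ N, Ω N → Fin N → Fin (K N)) (n : ℕ → ℕ) : Prop :=
  ∀ η : ℝ, 0 < η → η < 1 → ∃ Cη : ℝ, ∃ Nη : ℕ, ∀ N ≥ Nη,
    ∃ E : Set (Ω N), MeasurableSet E ∧ 1 - η ≤ (P N).real E ∧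
      ∀ (k : Fin (K N)) (a : Fin N → Ω N → ℝ),
        (∀ i, Measurable[trainField (A N) (κ N) k] (a i)) →
        ∀ᵐ ω ∂(P N), ω ∈ E →
          ((P N)[fun ω' => fluct (P N) (A N) (κ N) k a ω' ^ 2 | trainField (A N) (κ N) k]) ω
            ≤ Cη / n N * foldMeanSq (κ N) k a ω

end Sequence

end SurveySampling

end

/-!
Given the labels and the sample outside the fold, the part of a rejective sample inside the fold
is again rejective, with size `#(A ∩ U_k)`. Inclusion indicators of a rejective sample are
negatively correlated, so the conditional variance of `D_k` is of order `N_k⁻² ∑ a_i²`. For the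
conditional bias one compares the inclusion probabilities of two rejective designs on `U_k`:
raising the size by one changes each of them by a normalized Turán difference of elementary
symmetric polynomials, which is `O(1 / N_k)` when the weights are comparable. Negative correlation
also gives `Var #(A ∩ U_k) ≤ N_k`, so by Chebyshev the realized size is `O(√N_k)` away from its
mean, the inclusion probabilities move by `O(1 / √N_k)`, and Cauchy–Schwarz bounds the squared bias
by the order of the variance.
-/

noncomputable section

namespace SurveySampling

open Finset

section Combinatorics

variable {ι : Type*}

/-- The weighted sum `∑ (∏_{i ∈ t} w_i) F(t)` over the subsets `t` of `S` of size `m`. The size is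
an integer so that the Pascal recursion `rejSum_insert` needs no case distinction at `m = 0`. -/
def rejSum (w : ι → ℝ) (S : Finset ι) (m : ℤ) (F : Finset ι → ℝ) : ℝ :=
  ∑ t ∈ S.powerset with (#t : ℤ) = m, (∏ i ∈ t, w i) * F t

/-- The elementary symmetric polynomial of degree `m` in the weights indexed by `S`; it vanishes
for `m < 0`. -/
def esymm (w : ι → ℝ) (S : Finset ι) (m : ℤ) : ℝ :=
  rejSum w S m fun _ => 1

/-- The expectation of `F` under the rejective law of size `m` on `S`. It is `0` when no subset
of `S` has size `m`. -/
def rejMean (w : ι → ℝ) (S : Finset ι) (m : ℤ) (F : Finset ι → ℝ) : ℝ :=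
  rejSum w S m F / esymm w S m

/-- The Turán difference `e_m² - e_{m-1} e_{m+1}` of the elementary symmetric polynomials. -/
def turan (w : ι → ℝ) (S : Finset ι) (m : ℤ) : ℝ :=
  esymm w S m ^ 2 - esymm w S (m - 1) * esymm w S (m + 1)

variable {w : ι → ℝ} {S : Finset ι} {m : ℤ} {F G : Finset ι → ℝ}

lemma rejSum_congr (h : ∀ t ⊆ S, (#t : ℤ) = m → F t = G t) : rejSum w S m F = rejSum w S m G :=
  sum_congr rfl fun t ht => by
    rw [mem_filter, mem_powerset] at ht
    rw [h t ht.1 ht.2]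

lemma rejSum_mono (hw : ∀ i, 0 ≤ w i) (h : ∀ t ⊆ S, (#t : ℤ) = m → F t ≤ G t) :
    rejSum w S m F ≤ rejSum w S m G :=
  sum_le_sum fun t ht => by
    rw [mem_filter, mem_powerset] at ht
    exact mul_le_mul_of_nonneg_left (h t ht.1 ht.2) (prod_nonneg fun i _ => hw i)

lemma rejSum_add (w : ι → ℝ) (S : Finset ι) (m : ℤ) (F G : Finset ι → ℝ) :
    rejSum w S m (fun t => F t + G t) = rejSum w S m F + rejSum w S m G := by
  simp only [rejSum, mul_add, sum_add_distrib]

lemma rejSum_const_mul (w : ι → ℝ) (S : Finset ι) (m : ℤ) (c : ℝ) (F : Finset ι → ℝ) :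
    rejSum w S m (fun t => c * F t) = c * rejSum w S m F := by
  simp only [rejSum, mul_sum, mul_left_comm]

lemma rejSum_const (w : ι → ℝ) (S : Finset ι) (m : ℤ) (c : ℝ) :
    rejSum w S m (fun _ => c) = c * esymm w S m := by
  simpa only [mul_one, esymm] using rejSum_const_mul w S m c fun _ => 1

lemma esymm_nonneg (hw : ∀ i, 0 ≤ w i) (S : Finset ι) (m : ℤ) : 0 ≤ esymm w S m :=
  sum_nonneg fun _ _ => mul_nonneg (prod_nonneg fun i _ => hw i) zero_le_one

lemma esymm_empty (w : ι → ℝ) (m : ℤ) : esymm w ∅ m = if m = 0 then 1 else 0 := by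
  simp [esymm, rejSum, sum_filter, eq_comm]

lemma esymm_pos (hw : ∀ i, 0 < w i) {k : ℕ} (hk : k ≤ #S) : 0 < esymm w S k := by
  obtain ⟨t, hts, ht⟩ := exists_subset_card_eq hk
  refine sum_pos (fun t _ => mul_pos (prod_pos fun i _ => hw i) one_pos) ⟨t, ?_⟩
  simpa [ht] using hts

lemma rejSum_eq_esymm_mul_rejMean (hw : ∀ i, 0 ≤ w i) (S : Finset ι) (m : ℤ)
    (F : Finset ι → ℝ) : rejSum w S m F = esymm w S m * rejMean w S m F := by
  refine (mul_div_cancel_of_imp' fun hZ => sum_eq_zero fun t ht => ?_).symm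
  have hprod := (sum_eq_zero_iff_of_nonneg fun t _ =>
    mul_nonneg (prod_nonneg fun i _ => hw i) zero_le_one).1 hZ t ht
  rw [mul_one] at hprod
  rw [hprod, zero_mul]

lemma rejMean_congr (h : ∀ t ⊆ S, (#t : ℤ) = m → F t = G t) : rejMean w S m F = rejMean w S m G :=
  congrArg (· / _) (rejSum_congr h)

lemma rejMean_mono (hw : ∀ i, 0 ≤ w i) (h : ∀ t ⊆ S, (#t : ℤ) = m → F t ≤ G t) :
    rejMean w S m F ≤ rejMean w S m G :=
  div_le_div_of_nonneg_right (rejSum_mono hw h) (esymm_nonneg hw S m)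

lemma rejMean_add (w : ι → ℝ) (S : Finset ι) (m : ℤ) (F G : Finset ι → ℝ) :
    rejMean w S m (fun t => F t + G t) = rejMean w S m F + rejMean w S m G := by
  rw [rejMean, rejSum_add, add_div, rejMean, rejMean]

lemma rejMean_const_mul (w : ι → ℝ) (S : Finset ι) (m : ℤ) (c : ℝ) (F : Finset ι → ℝ) :
    rejMean w S m (fun t => c * F t) = c * rejMean w S m F := by
  rw [rejMean, rejSum_const_mul, mul_div_assoc, rejMean]

lemma rejMean_sub (w : ι → ℝ) (S : Finset ι) (m : ℤ) (F G : Finset ι → ℝ) :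
    rejMean w S m (fun t => F t - G t) = rejMean w S m F - rejMean w S m G := by
  rw [sub_eq_add_neg, ← neg_one_mul, ← rejMean_const_mul, ← rejMean_add]
  simp only [neg_one_mul, sub_eq_add_neg]

lemma rejMean_sum {α : Type*} (w : ι → ℝ) (S : Finset ι) (m : ℤ) (T : Finset α)
    (F : α → Finset ι → ℝ) :
    rejMean w S m (fun t => ∑ x ∈ T, F x t) = ∑ x ∈ T, rejMean w S m (F x) := by
  simp only [rejMean, rejSum, mul_sum, ← sum_div]
  rw [sum_comm]

lemma rejMean_const (hZ : 0 < esymm w S m) (c : ℝ) : rejMean w S m (fun _ => c) = c := by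
  rw [rejMean, rejSum_const, mul_div_cancel_right₀ _ hZ.ne']

lemma rejMean_const_le (w : ι → ℝ) (S : Finset ι) (m : ℤ) {c : ℝ} (hc : 0 ≤ c) :
    rejMean w S m (fun _ => c) ≤ c := by
  rw [rejMean, rejSum_const, mul_div_assoc]
  exact mul_le_of_le_one_right hc (div_self_le_one _)

lemma abs_rejMean_le (hw : ∀ i, 0 ≤ w i) (S : Finset ι) (m : ℤ) (F : Finset ι → ℝ) :
    |rejMean w S m F| ≤ rejMean w S m fun t => |F t| := by
  refine abs_le.2 ⟨?_, rejMean_mono hw fun t _ _ => le_abs_self _⟩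
  rw [neg_le, ← neg_one_mul, ← rejMean_const_mul]
  exact rejMean_mono hw fun t _ _ => by simpa using neg_le_abs (F t)

lemma rejMean_abs_le_of_rejMean_sq_le (hw : ∀ i, 0 ≤ w i) (hZ : 0 < esymm w S m) {r : ℝ}
    (hr : 0 < r) (hF : rejMean w S m (fun t => F t ^ 2) ≤ r ^ 2) :
    rejMean w S m (fun t => |F t|) ≤ r := by
  have hamgm : ∀ x : ℝ, |x| ≤ r / 2 + (2 * r)⁻¹ * x ^ 2 := fun x => by
    rw [← sub_nonneg, ← sq_abs x,
      show r / 2 + (2 * r)⁻¹ * |x| ^ 2 - |x| = (2 * r)⁻¹ * (|x| - r) ^ 2 by field_simp; ring]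
    positivity
  calc rejMean w S m (fun t => |F t|)
      ≤ rejMean w S m fun t => r / 2 + (2 * r)⁻¹ * F t ^ 2 :=
        rejMean_mono hw fun t _ _ => hamgm (F t)
    _ = r / 2 + (2 * r)⁻¹ * rejMean w S m fun t => F t ^ 2 := by
        rw [rejMean_add, rejMean_const hZ, rejMean_const_mul]
    _ ≤ r / 2 + (2 * r)⁻¹ * r ^ 2 := by gcongr
    _ = r := by field_simp; norm_num

lemma rejSum_insert [DecidableEq ι] {i : ι} (w : ι → ℝ) (m : ℤ) (F : Finset ι → ℝ)
    (hi : i ∉ S) :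
    rejSum w (insert i S) m F =
      rejSum w S m F + w i * rejSum w S (m - 1) fun t => F (insert i t) := by
  simp only [rejSum, sum_filter]
  rw [sum_powerset_insert hi, mul_sum]
  congr 1
  refine sum_congr rfl fun t ht => ?_
  have hit : i ∉ t := notMem_mono (mem_powerset.1 ht) hi
  rw [card_insert_of_notMem hit, prod_insert hit, mul_ite, mul_zero, mul_assoc, Nat.cast_succ]
  simp only [eq_sub_iff_add_eq]

lemma esymm_logConcave (hw : ∀ i, 0 ≤ w i) (S : Finset ι) :
    ∀ a b : ℤ, a ≤ b → esymm w S (a - 1) * esymm w S (b + 1) ≤ esymm w S a * esymm w S b := by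
  classical
  induction S using Finset.induction_on with
  | empty =>
    intro a b hab
    simp only [esymm_empty]
    split_ifs <;> first | omega | norm_num
  | insert i S hi ih =>
    intro a b hab
    have hrec : ∀ m, esymm w (insert i S) m = esymm w S m + w i * esymm w S (m - 1) :=
      fun m => rejSum_insert w m _ hi
    have hsame : esymm w S (a - 1 - 1) * esymm w S b ≤ esymm w S (a - 1) * esymm w S (b - 1) := by
      simpa using ih (a - 1) (b - 1) (by omega)
    have hwide : esymm w S (a - 1 - 1) * esymm w S (b + 1) ≤ esymm w S a * esymm w S (b - 1) := by
      have houter := ih (a - 1) b (by omega)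
      rcases hab.lt_or_eq with hlt | rfl
      · have hinner := ih a (b - 1) (by omega)
        rw [sub_add_cancel] at hinner
        exact houter.trans hinner
      · exact houter.trans_eq (mul_comm _ _)
    rw [hrec, hrec, hrec, hrec, add_sub_cancel_right]
    linear_combination ih a b hab + mul_le_mul_of_nonneg_left hwide (hw i) +
      mul_le_mul_of_nonneg_left hsame (mul_nonneg (hw i) (hw i))

lemma turan_nonneg (hw : ∀ i, 0 ≤ w i) (S : Finset ι) (m : ℤ) : 0 ≤ turan w S m :=
  sub_nonneg.2 ((esymm_logConcave hw S m m le_rfl).trans_eq (sq _).symm)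

variable [DecidableEq ι] {U : Finset ι} {i j : ι}

/-- The membership indicator of `i` in `t`. -/
def memInd (i : ι) (t : Finset ι) : ℝ := if i ∈ t then 1 else 0

/-- The inclusion probability of `i` under the rejective law of size `m` on `S`. -/
def rejIncl (w : ι → ℝ) (S : Finset ι) (m : ℤ) (i : ι) : ℝ :=
  rejMean w S m (memInd i)

lemma sum_memInd (U t : Finset ι) : ∑ i ∈ U, memInd i t = #(t ∩ U) := by
  simp [memInd, inter_comm]

lemma rejSum_erase (w : ι → ℝ) (m : ℤ) (F : Finset ι → ℝ) (hi : i ∈ S) :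
    rejSum w S m F =
      rejSum w (S.erase i) m F + w i * rejSum w (S.erase i) (m - 1) fun t => F (insert i t) := by
  rw [← rejSum_insert w m F (notMem_erase i S), insert_erase hi]

lemma esymm_erase (w : ι → ℝ) (m : ℤ) (hi : i ∈ S) :
    esymm w S m = esymm w (S.erase i) m + w i * esymm w (S.erase i) (m - 1) :=
  rejSum_erase w m _ hi

lemma memInd_mem_Icc (i : ι) (t : Finset ι) : memInd i t ∈ Set.Icc (0 : ℝ) 1 := by
  unfold memInd
  split_ifs <;> simp

lemma rejSum_memInd_mul (w : ι → ℝ) (m : ℤ) (F : Finset ι → ℝ) (hi : i ∈ S) :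
    rejSum w S m (fun t => memInd i t * F t) =
      w i * rejSum w (S.erase i) (m - 1) fun t => F (insert i t) := by
  have hout : rejSum w (S.erase i) m (fun t => memInd i t * F t) = 0 := by
    rw [rejSum_congr (G := fun _ => 0) fun t ht _ => by
      rw [memInd, if_neg fun h => notMem_erase i S (ht h), zero_mul], rejSum_const, zero_mul]
  rw [rejSum_erase w m _ hi, hout, zero_add]
  simp only [memInd, mem_insert_self, if_true, one_mul]

lemma rejSum_memInd (w : ι → ℝ) (m : ℤ) (hi : i ∈ S) :
    rejSum w S m (memInd i) = w i * esymm w (S.erase i) (m - 1) := by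
  simpa only [mul_one, esymm] using! rejSum_memInd_mul w m (fun _ => 1) hi

lemma rejSum_memInd_mul_memInd (w : ι → ℝ) (m : ℤ) (hi : i ∈ S) (hj : j ∈ S) (hij : i ≠ j) :
    rejSum w S m (fun t => memInd i t * memInd j t) =
      w i * (w j * esymm w ((S.erase i).erase j) (m - 1 - 1)) := by
  have hins : (fun t => memInd j (insert i t)) = memInd j := by
    funext t
    simp only [memInd, mem_insert, hij.symm, false_or]
  rw [rejSum_memInd_mul w m _ hi, hins, rejSum_memInd w _ (mem_erase.2 ⟨hij.symm, hj⟩)]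

lemma rejIncl_eq (w : ι → ℝ) (m : ℤ) (hi : i ∈ S) :
    rejIncl w S m i = w i * esymm w (S.erase i) (m - 1) / esymm w S m := by
  rw [rejIncl, rejMean, rejSum_memInd w m hi]

lemma rejIncl_nonneg (hw : ∀ i, 0 ≤ w i) (S : Finset ι) (m : ℤ) (i : ι) :
    0 ≤ rejIncl w S m i :=
  div_nonneg (sum_nonneg fun t _ => mul_nonneg (prod_nonneg fun i _ => hw i)
    (memInd_mem_Icc i t).1) (esymm_nonneg hw S m)

lemma rejIncl_le_one (hw : ∀ i, 0 ≤ w i) (S : Finset ι) (m : ℤ) (i : ι) :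
    rejIncl w S m i ≤ 1 :=
  (rejMean_mono hw fun t _ _ => (memInd_mem_Icc i t).2).trans (rejMean_const_le w S m zero_le_one)

lemma sum_rejIncl (hZ : 0 < esymm w S m) : ∑ i ∈ S, rejIncl w S m i = m := by
  have hcount : rejMean w S m (fun t => ∑ i ∈ S, memInd i t) = rejMean w S m fun _ => m :=
    rejMean_congr fun t hts ht => by
      rw [sum_memInd, inter_eq_left.2 hts]
      exact_mod_cast ht
  rwa [rejMean_sum, rejMean_const hZ] at hcount

/-- After clearing denominators this is log-concavity, in degree `m - 1`, of the elementary
symmetric polynomials in the weights outside `{i, j}`. -/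
lemma rejMean_memInd_mul_memInd_le (hw : ∀ i, 0 ≤ w i) (hZ : 0 < esymm w S m) (hi : i ∈ S)
    (hj : j ∈ S) (hij : i ≠ j) :
    rejMean w S m (fun t => memInd i t * memInd j t) ≤ rejIncl w S m i * rejIncl w S m j := by
  have hj' : j ∈ S.erase i := mem_erase.2 ⟨hij.symm, hj⟩
  have hi' : i ∈ S.erase j := mem_erase.2 ⟨hij, hi⟩
  rw [rejMean, rejSum_memInd_mul_memInd w m hi hj hij, rejIncl_eq w m hi, rejIncl_eq w m hj,
    div_mul_div_comm, div_le_div_iff₀ hZ (mul_pos hZ hZ), ← mul_assoc _ (esymm w S m)]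
  refine mul_le_mul_of_nonneg_right ?_ hZ.le
  rw [esymm_erase w m hi, esymm_erase w m hj', esymm_erase w (m - 1) hj',
    esymm_erase w (m - 1) hi', erase_right_comm (a := j)]
  have hlog := esymm_logConcave hw ((S.erase i).erase j) (m - 1) (m - 1) le_rfl
  rw [sub_add_cancel] at hlog
  linear_combination mul_le_mul_of_nonneg_left hlog (mul_nonneg (hw i) (hw j))

/-- Exchanging `j` for `i` in a sample containing `j` but not `i` multiplies its weight by
`w i / w j`. -/
lemma rejIncl_mul_one_sub_rejIncl_mul_le (hw : ∀ i, 0 ≤ w i) (hZ : 0 < esymm w S m) (hi : i ∈ S)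
    (hj : j ∈ S) : rejIncl w S m j * (1 - rejIncl w S m i) * w i ≤ w j := by
  have hj1 := rejIncl_le_one hw S m j
  have hj0 := rejIncl_nonneg hw S m j
  rcases eq_or_ne i j with rfl | hij
  · exact mul_le_of_le_one_left (hw i) (mul_le_one₀ hj1 (by linarith) (by linarith))
  have hi' : i ∈ S.erase j := mem_erase.2 ⟨hij, hi⟩
  have hj' : j ∈ S.erase i := mem_erase.2 ⟨hij.symm, hj⟩
  set V := (S.erase i).erase j with hV
  set q := rejMean w S m (fun t => memInd i t * memInd j t) with hq
  have hq0 : 0 ≤ q := by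
    rw [hq, ← rejMean_const hZ 0]
    exact rejMean_mono hw fun t _ _ => mul_nonneg (memInd_mem_Icc i t).1 (memInd_mem_Icc j t).1
  have hqval : q = w i * (w j * esymm w V (m - 1 - 1)) / esymm w S m := by
    rw [hq, rejMean, rejSum_memInd_mul_memInd w m hi hj hij]
  have hjNotI : rejIncl w S m j - q = w j * (esymm w V (m - 1) / esymm w S m) := by
    rw [rejIncl_eq w m hj, hqval, esymm_erase w _ hi', erase_right_comm, ← hV]
    ring
  have hiNotJ : rejIncl w S m i - q = w i * (esymm w V (m - 1) / esymm w S m) := by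
    rw [rejIncl_eq w m hi, hqval, esymm_erase w _ hj', ← hV]
    ring
  have hneg := rejMean_memInd_mul_memInd_le hw hZ hi hj hij
  calc rejIncl w S m j * (1 - rejIncl w S m i) * w i
      ≤ (rejIncl w S m j - q) * w i :=
        mul_le_mul_of_nonneg_right (by linear_combination hneg) (hw i)
    _ = (rejIncl w S m i - q) * w j := by rw [hjNotI, hiNotJ]; ring
    _ ≤ w j := mul_le_of_le_one_left (hw j) (by linarith [rejIncl_le_one hw S m i])

lemma rejIncl_succ_sub (h0 : esymm w S m ≠ 0) (h1 : esymm w S (m + 1) ≠ 0) (hi : i ∈ S) :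
    rejIncl w S (m + 1) i - rejIncl w S m i =
      w i * turan w (S.erase i) m / (esymm w S m * esymm w S (m + 1)) := by
  rw [rejIncl_eq w m hi, rejIncl_eq w (m + 1) hi, add_sub_cancel_right, div_sub_div _ _ h1 h0,
    mul_comm (esymm w S m) (esymm w S (m + 1)), turan]
  congr 1
  rw [esymm_erase w m hi, esymm_erase w (m + 1) hi, add_sub_cancel_right]
  ring

lemma turan_eq_erase (w : ι → ℝ) (m : ℤ) (hi : i ∈ S) :
    turan w S m = turan w (S.erase i) m +
      w i * (esymm w (S.erase i) (m - 1) * esymm w (S.erase i) m -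
        esymm w (S.erase i) (m - 1 - 1) * esymm w (S.erase i) (m + 1)) +
      w i * w i * turan w (S.erase i) (m - 1) := by
  unfold turan
  rw [esymm_erase w m hi, esymm_erase w (m - 1) hi, esymm_erase w (m + 1) hi,
    add_sub_cancel_right, sub_add_cancel]
  ring

lemma mul_turan_erase_le (hw : ∀ i, 0 ≤ w i) (m : ℤ) (hi : i ∈ S) (hj : j ∈ S) {R : ℝ}
    (hR : 1 ≤ R) (hij : w i ≤ R * w j) (hji : w j ≤ R * w i) :
    w i * turan w (S.erase i) m ≤ R * (w j * turan w (S.erase j) m) := by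
  rcases eq_or_ne i j with rfl | hne
  · exact le_mul_of_one_le_left (mul_nonneg (hw i) (turan_nonneg hw _ _)) hR
  rw [turan_eq_erase w m (mem_erase.2 ⟨hne.symm, hj⟩), turan_eq_erase w m (mem_erase.2 ⟨hne, hi⟩),
    erase_right_comm (a := j)]
  set V := (S.erase i).erase j
  have hmid := sub_nonneg.2 (esymm_logConcave hw V (m - 1) m (by omega))
  have hwij := mul_nonneg (hw i) (hw j)
  linear_combination mul_le_mul_of_nonneg_right hij (turan_nonneg hw V m) +
    le_mul_of_one_le_left (mul_nonneg hwij hmid) hR +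
    mul_le_mul_of_nonneg_right hji (mul_nonneg hwij (turan_nonneg hw V (m - 1)))

lemma rejIncl_succ_sub_mem_Icc (hw : ∀ i, 0 < w i) {m : ℕ} (hm : m + 1 ≤ #S) {R : ℝ}
    (hratio : ∀ i ∈ S, ∀ j ∈ S, w i ≤ R * w j) (hi : i ∈ S) :
    rejIncl w S (m + 1) i - rejIncl w S m i ∈ Set.Icc 0 (R / #S) := by
  have hw' := fun i => (hw i).le
  have h0 : 0 < esymm w S m := esymm_pos hw (by omega)
  have h1 : 0 < esymm w S (m + 1) := mod_cast esymm_pos hw hm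
  have hR : 1 ≤ R := le_of_mul_le_mul_right ((one_mul _).trans_le (hratio i hi i hi)) (hw i)
  constructor
  · rw [rejIncl_succ_sub h0.ne' h1.ne' hi]
    exact div_nonneg (mul_nonneg (hw' i) (turan_nonneg hw' _ _)) (mul_pos h0 h1).le
  · have hle : ∀ j ∈ S, rejIncl w S (m + 1) i - rejIncl w S m i ≤
        R * (rejIncl w S (m + 1) j - rejIncl w S m j) := fun j hj => by
      rw [rejIncl_succ_sub h0.ne' h1.ne' hi, rejIncl_succ_sub h0.ne' h1.ne' hj, ← mul_div_assoc]
      exact div_le_div_of_nonneg_right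
        (mul_turan_erase_le hw' m hi hj hR (hratio i hi j hj) (hratio j hj i hi))
        (mul_pos h0 h1).le
    have hsum := sum_le_sum hle
    rw [← mul_sum, sum_const, nsmul_eq_mul, sum_sub_distrib, sum_rejIncl h0, sum_rejIncl h1]
      at hsum
    rw [le_div_iff₀ (by exact_mod_cast card_pos.2 ⟨i, hi⟩)]
    push_cast at hsum
    linarith

lemma abs_rejIncl_sub_le (hw : ∀ i, 0 < w i) {R : ℝ} (hratio : ∀ i ∈ S, ∀ j ∈ S, w i ≤ R * w j)
    (hi : i ∈ S) {m m' : ℕ} (hm : m ≤ #S) (hm' : m' ≤ #S) :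
    |rejIncl w S m i - rejIncl w S m' i| ≤ R / #S * |(m : ℝ) - m'| := by
  wlog hle : m' ≤ m generalizing m m'
  · rw [abs_sub_comm, abs_sub_comm (m : ℝ)]
    exact this hm' hm (by omega)
  induction m, hle using Nat.le_induction with
  | base => simp
  | succ m hle ih =>
    have hstep := rejIncl_succ_sub_mem_Icc hw hm hratio hi
    have hm0 : (0 : ℝ) ≤ m - m' := sub_nonneg.2 (mod_cast hle)
    calc |rejIncl w S (m + 1 : ℕ) i - rejIncl w S m' i|
        ≤ |rejIncl w S (m + 1) i - rejIncl w S m i| + |rejIncl w S m i - rejIncl w S m' i| :=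
          abs_sub_le _ _ _
      _ ≤ R / #S + R / #S * |(m : ℝ) - m'| :=
          add_le_add ((abs_of_nonneg hstep.1).trans_le hstep.2) (ih (by omega))
      _ = R / #S * |((m + 1 : ℕ) : ℝ) - m'| := by
          rw [abs_of_nonneg hm0, abs_of_nonneg (by push_cast; linarith)]
          push_cast
          ring

lemma rejMean_centered_mul_centered_le (hw : ∀ i, 0 ≤ w i) (hZ : 0 < esymm w S m) (hi : i ∈ S)
    (hj : j ∈ S) :
    rejMean w S m (fun t => (memInd i t - rejIncl w S m i) * (memInd j t - rejIncl w S m j)) ≤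
      if i = j then 1 else 0 := by
  have hi0 := rejIncl_nonneg hw S m i
  have hi1 := rejIncl_le_one hw S m i
  split_ifs with hij
  · subst hij
    refine (rejMean_mono hw fun t _ _ => ?_).trans (rejMean_const hZ 1).le
    have ht := memInd_mem_Icc i t
    rw [← sq, sq_le_one_iff_abs_le_one, abs_le]
    constructor <;> linarith [ht.1, ht.2]
  · have hexpand : rejMean w S m
        (fun t => (memInd i t - rejIncl w S m i) * (memInd j t - rejIncl w S m j)) =
        rejMean w S m (fun t => memInd i t * memInd j t) - rejIncl w S m i * rejIncl w S m j := by
      simp only [sub_mul, mul_sub, rejMean_sub, rejMean_const_mul, rejMean_const hZ,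
        mul_comm (memInd i _) (rejIncl w S m j)]
      simp only [rejIncl]
      ring
    rw [hexpand]
    exact sub_nonpos.2 (rejMean_memInd_mul_memInd_le hw hZ hi hj hij)

lemma rejMean_sq_sum_centered_le_of_nonneg (hw : ∀ i, 0 ≤ w i) (hZ : 0 < esymm w S m)
    (hU : U ⊆ S) {b : ι → ℝ} (hb : ∀ i, 0 ≤ b i) :
    rejMean w S m (fun t => (∑ i ∈ U, b i * (memInd i t - rejIncl w S m i)) ^ 2) ≤
      ∑ i ∈ U, b i ^ 2 := by
  simp only [sq, sum_mul_sum, mul_mul_mul_comm (b _), rejMean_sum, rejMean_const_mul]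
  calc _ ≤ ∑ i ∈ U, ∑ j ∈ U, b i * b j * if i = j then 1 else 0 :=
        sum_le_sum fun i hi => sum_le_sum fun j hj => mul_le_mul_of_nonneg_left
          (rejMean_centered_mul_centered_le hw hZ (hU hi) (hU hj)) (mul_nonneg (hb i) (hb j))
    _ = ∑ i ∈ U, b i * b i := sum_congr rfl fun i hi => by simp [hi]

lemma rejMean_sq_sum_centered_le (hw : ∀ i, 0 ≤ w i) (hZ : 0 < esymm w S m) (hU : U ⊆ S)
    (b : ι → ℝ) :
    rejMean w S m (fun t => (∑ i ∈ U, b i * (memInd i t - rejIncl w S m i)) ^ 2) ≤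
      2 * ∑ i ∈ U, b i ^ 2 := by
  have hpos := rejMean_sq_sum_centered_le_of_nonneg hw hZ hU fun i => posPart_nonneg (b i)
  have hneg := rejMean_sq_sum_centered_le_of_nonneg hw hZ hU fun i => negPart_nonneg (b i)
  have hsplit : ∀ t, (∑ i ∈ U, b i * (memInd i t - rejIncl w S m i)) ^ 2 ≤
      2 * (∑ i ∈ U, (b i)⁺ * (memInd i t - rejIncl w S m i)) ^ 2 +
        2 * (∑ i ∈ U, (b i)⁻ * (memInd i t - rejIncl w S m i)) ^ 2 := fun t => by
    have hdiff : ∑ i ∈ U, b i * (memInd i t - rejIncl w S m i) =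
        ∑ i ∈ U, (b i)⁺ * (memInd i t - rejIncl w S m i) -
          ∑ i ∈ U, (b i)⁻ * (memInd i t - rejIncl w S m i) := by
      simp only [← sum_sub_distrib, ← sub_mul, posPart_sub_negPart]
    rw [hdiff, ← mul_add]
    simpa only [sub_eq_add_neg, neg_sq] using add_sq_le (b := -∑ i ∈ U, (b i)⁻ * _)
  have hsq : ∀ i, b i ^ 2 = (b i)⁺ ^ 2 + (b i)⁻ ^ 2 := fun i => by
    rcases le_total 0 (b i) with h | h <;> simp [h]
  refine (rejMean_mono hw fun t _ _ => hsplit t).trans ?_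
  rw [rejMean_add, rejMean_const_mul, rejMean_const_mul]
  simp only [hsq, sum_add_distrib]
  linarith

lemma rejMean_sq_card_inter_sub_le (hw : ∀ i, 0 ≤ w i) (hZ : 0 < esymm w S m) (hU : U ⊆ S) :
    rejMean w S m (fun t => (#(t ∩ U) - ∑ i ∈ U, rejIncl w S m i) ^ 2) ≤ #U := by
  simpa only [one_mul, sum_sub_distrib, sum_memInd, one_pow, sum_const, nsmul_one]
    using rejMean_sq_sum_centered_le_of_nonneg hw hZ hU (b := fun _ => 1) fun _ => zero_le_one

lemma rejSum_union {V : Finset ι} (w : ι → ℝ) (hVU : Disjoint V U) (m : ℤ)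
    (F : Finset ι → ℝ) :
    rejSum w (V ∪ U) m F =
      ∑ B ∈ V.powerset, (∏ i ∈ B, w i) * rejSum w U (m - #B) fun t => F (B ∪ t) := by
  induction V using Finset.induction_on generalizing m F with
  | empty => simp
  | insert i V hi ih =>
    rw [disjoint_insert_left] at hVU
    rw [insert_union, rejSum_insert w m F (by simp [hi, hVU.1]), ih hVU.2, ih hVU.2,
      sum_powerset_insert hi, mul_sum]
    congr 1
    refine sum_congr rfl fun B hB => ?_
    have hiB : i ∉ B := notMem_mono (mem_powerset.1 hB) hi
    rw [prod_insert hiB, card_insert_of_notMem hiB, Nat.cast_succ, mul_assoc, sub_sub,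
      add_comm (1 : ℤ)]
    simp only [insert_union]

/-- Given its part outside `U`, a rejective sample from `S` is rejective inside `U`, with the
size of its trace on `U`. -/
lemma rejMean_eq_rejMean_rejMean (hw : ∀ i, 0 ≤ w i) (hU : U ⊆ S) (m : ℤ) (F : Finset ι → ℝ) :
    rejMean w S m F =
      rejMean w S m fun s => rejMean w U #(s ∩ U) fun t => F (s \ U ∪ t) := by
  refine congrArg (· / _) ?_
  rw [← sdiff_union_of_subset hU, rejSum_union w sdiff_disjoint, rejSum_union w sdiff_disjoint]
  refine sum_congr rfl fun B hB => congrArg _ ?_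
  have hBU : Disjoint B U := disjoint_of_subset_left (mem_powerset.1 hB) sdiff_disjoint
  have hinner : ∀ t ⊆ U, (#t : ℤ) = m - #B →
      rejMean w U #((B ∪ t) ∩ U) (fun t' => F ((B ∪ t) \ U ∪ t')) =
        rejMean w U (m - #B) fun t' => F (B ∪ t') := fun t htU ht => by
    rw [union_inter_distrib_right, disjoint_iff_inter_eq_empty.1 hBU, empty_union,
      inter_eq_left.2 htU, ht,
      union_sdiff_distrib, sdiff_eq_self_of_disjoint hBU, sdiff_eq_empty_iff_subset.2 htU,
      union_empty]
  rw [rejSum_congr hinner, rejSum_const, rejSum_eq_esymm_mul_rejMean hw, mul_comm]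

lemma memInd_sdiff_union (hi : i ∈ U) (s t : Finset ι) : memInd i (s \ U ∪ t) = memInd i t := by
  simp [memInd, hi]

lemma sdiff_union_sdiff_of_subset {t : Finset ι} (ht : t ⊆ U) (s : Finset ι) :
    (s \ U ∪ t) \ U = s \ U := by
  rw [union_sdiff_distrib, sdiff_eq_empty_iff_subset.2 ht, union_empty, Finset.sdiff_idem]

lemma rejIncl_eq_rejMean_rejIncl (hw : ∀ i, 0 ≤ w i) (hU : U ⊆ S) (m : ℤ) (hi : i ∈ U) :
    rejIncl w S m i = rejMean w S m fun s => rejIncl w U #(s ∩ U) i := by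
  rw [rejIncl, rejMean_eq_rejMean_rejMean hw hU]
  simp only [memInd_sdiff_union hi]
  rfl

lemma abs_rejIncl_sub_rejIncl_le (hw : ∀ i, 0 < w i) (hU : U ⊆ S) (hZ : 0 < esymm w S m) {R τ : ℝ}
    (hratio : ∀ i ∈ U, ∀ j ∈ U, w i ≤ R * w j) {m₀ : ℕ} (hm₀ : m₀ ≤ #U)
    (hdev : |m₀ - ∑ i ∈ U, rejIncl w S m i| ≤ τ * √(#U)) (hi : i ∈ U) :
    |rejIncl w U m₀ i - rejIncl w S m i| ≤ R * (τ + 1) / √(#U) := by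
  have hw' := fun i => (hw i).le
  have hcard : (0 : ℝ) < #U := mod_cast card_pos.2 ⟨i, hi⟩
  have hR : 0 ≤ R := pos_of_mul_pos_left ((hw i).trans_le (hratio i hi i hi)) (hw' i) |>.le
  set μ := ∑ i ∈ U, rejIncl w S m i
  have hspread : rejMean w S m (fun s => |#(s ∩ U) - μ|) ≤ √(#U) :=
    rejMean_abs_le_of_rejMean_sq_le hw' hZ (Real.sqrt_pos.2 hcard)
      ((rejMean_sq_card_inter_sub_le hw' hZ hU).trans_eq (Real.sq_sqrt hcard.le).symm)
  have hlip : ∀ s : Finset ι, |rejIncl w U m₀ i - rejIncl w U #(s ∩ U) i| ≤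
      R / #U * (τ * √(#U) + |#(s ∩ U) - μ|) := fun s => by
    refine (abs_rejIncl_sub_le hw hratio hi hm₀ (card_le_card inter_subset_right)).trans ?_
    gcongr
    rw [abs_sub_comm _ μ]
    exact (abs_sub_le _ μ _).trans (add_le_add_left hdev _)
  calc |rejIncl w U m₀ i - rejIncl w S m i|
      = |rejMean w S m fun s => rejIncl w U m₀ i - rejIncl w U #(s ∩ U) i| := by
        rw [rejMean_sub, rejMean_const hZ, ← rejIncl_eq_rejMean_rejIncl hw' hU m hi]
    _ ≤ rejMean w S m fun s => R / #U * (τ * √(#U) + |#(s ∩ U) - μ|) :=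
        (abs_rejMean_le hw' S m _).trans (rejMean_mono hw' fun s _ _ => hlip s)
    _ = R / #U * (τ * √(#U) + rejMean w S m fun s => |#(s ∩ U) - μ|) := by
        rw [rejMean_const_mul, rejMean_add, rejMean_const hZ]
    _ ≤ R / #U * (τ * √(#U) + √(#U)) := by gcongr
    _ = R * (τ + 1) / √(#U) := by
        have hsqrt := Real.mul_self_sqrt hcard.le
        field_simp
        linear_combination (R * (τ + 1)) * hsqrt

lemma rejMean_sq_sum_sub_le (hw : ∀ i, 0 ≤ w i) (hZ : 0 < esymm w U m) {L : ℝ} {π : ι → ℝ}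
    (hbias : ∀ i ∈ U, |rejIncl w U m i - π i| ≤ L / √(#U)) (b : ι → ℝ) :
    rejMean w U m (fun t => (∑ i ∈ U, b i * (memInd i t - π i)) ^ 2) ≤
      2 * (2 + L ^ 2) * ∑ i ∈ U, b i ^ 2 := by
  set B := ∑ i ∈ U, b i * (rejIncl w U m i - π i) with hB
  have hbiasSq : ∑ i ∈ U, (rejIncl w U m i - π i) ^ 2 ≤ L ^ 2 :=
    calc ∑ i ∈ U, (rejIncl w U m i - π i) ^ 2 ≤ ∑ _i ∈ U, L ^ 2 / #U :=
          sum_le_sum fun i hi => by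
            rw [← sq_abs, ← Real.sq_sqrt (Nat.cast_nonneg #U), ← div_pow]
            exact pow_le_pow_left₀ (abs_nonneg _) (hbias i hi) 2
      _ = #U * (L ^ 2 / #U) := by rw [sum_const, nsmul_eq_mul]
      _ ≤ L ^ 2 := by
          rw [mul_div_left_comm]
          exact mul_le_of_le_one_right (sq_nonneg L) (div_self_le_one _)
  have hBsq : B ^ 2 ≤ L ^ 2 * ∑ i ∈ U, b i ^ 2 :=
    (sum_mul_sq_le_sq_mul_sq U b _).trans <| by
      rw [mul_comm]
      exact mul_le_mul_of_nonneg_right hbiasSq (sum_nonneg fun i _ => sq_nonneg _)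
  have hsplit : ∀ t, (∑ i ∈ U, b i * (memInd i t - π i)) ^ 2 ≤
      2 * (∑ i ∈ U, b i * (memInd i t - rejIncl w U m i)) ^ 2 + 2 * B ^ 2 := fun t => by
    rw [show ∑ i ∈ U, b i * (memInd i t - π i) =
      ∑ i ∈ U, b i * (memInd i t - rejIncl w U m i) + B by
        rw [hB, ← sum_add_distrib]; exact sum_congr rfl fun i _ => by ring, ← mul_add]
    exact add_sq_le
  refine (rejMean_mono hw fun t _ _ => hsplit t).trans ?_
  rw [rejMean_add, rejMean_const_mul, rejMean_const hZ]
  linarith [rejMean_sq_sum_centered_le hw hZ Subset.rfl b]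

lemma rejMean_sq_mean_div_sub_one_le (hw : ∀ i, 0 ≤ w i) (hZ : 0 < esymm w U m) {p L : ℝ}
    (hp : 0 < p) {π : ι → ℝ} (hπ : ∀ i ∈ U, p ≤ π i)
    (hbias : ∀ i ∈ U, |rejIncl w U m i - π i| ≤ L / √(#U)) (a : ι → ℝ) :
    rejMean w U m (fun t => ((#U : ℝ)⁻¹ * ∑ i ∈ U, (memInd i t / π i - 1) * a i) ^ 2) ≤
      2 * (2 + L ^ 2) / p ^ 2 / #U * ((#U : ℝ)⁻¹ * ∑ i ∈ U, a i ^ 2) := by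
  have hfactor : ∀ t, ∑ i ∈ U, (memInd i t / π i - 1) * a i =
      ∑ i ∈ U, a i / π i * (memInd i t - π i) := fun t => sum_congr rfl fun i hi => by
    have hπi := (hp.trans_le (hπ i hi)).ne'
    field_simp
  have hdiv : ∑ i ∈ U, (a i / π i) ^ 2 ≤ (∑ i ∈ U, a i ^ 2) / p ^ 2 := by
    rw [sum_div]
    refine sum_le_sum fun i hi => ?_
    rw [div_pow]
    gcongr
    exact hπ i hi
  simp only [mul_pow, rejMean_const_mul, hfactor]
  calc _ ≤ ((#U : ℝ)⁻¹) ^ 2 * (2 * (2 + L ^ 2) * ((∑ i ∈ U, a i ^ 2) / p ^ 2)) :=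
        mul_le_mul_of_nonneg_left ((rejMean_sq_sum_sub_le hw hZ hbias _).trans
          (mul_le_mul_of_nonneg_left hdiv (by positivity))) (sq_nonneg _)
    _ = _ := by ring

end Combinatorics

section Design

variable {Ω : Type*} {N K : ℕ} {κ : Ω → Fin N → Fin K}

lemma card_mul_le_of_forall_le_card_fold {S : Finset (Fin K)} {x : ℝ} {ω : Ω}
    (h : ∀ k ∈ S, x ≤ #(fold κ k ω)) : #S * x ≤ N := by
  rw [← nsmul_eq_mul]
  calc #S • x ≤ ∑ k ∈ S, (#(fold κ k ω) : ℝ) := card_nsmul_le_sum S _ x h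
    _ = #{i | κ ω i ∈ S} := mod_cast sum_card_fiberwise_eq_card_filter univ S (κ ω)
    _ ≤ N := mod_cast card_finset_fin_le _

variable [mΩ : MeasurableSpace Ω] {P : Measure Ω} {A : Ω → Finset (Fin N)} {n : ℕ} {w : Fin N → ℝ}

lemma measurableSet_of_label_sample (hA : Measurable A) (hκ : Measurable κ)
    (Q : (Fin N → Fin K) → Finset (Fin N) → Prop) : MeasurableSet {ω | Q (κ ω) (A ω)} :=
  (hκ.prodMk hA) (Set.toFinite {x : (Fin N → Fin K) × Finset (Fin N) | Q x.1 x.2}).measurableSet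

lemma integrable_label_sample [IsFiniteMeasure P] (hA : Measurable A) (hκ : Measurable κ)
    (H : (Fin N → Fin K) → Finset (Fin N) → ℝ) : Integrable (fun ω => H (κ ω) (A ω)) P :=
  (Integrable.of_finite (μ := P.map fun ω => (κ ω, A ω))
    (f := fun x => H x.1 x.2)).comp_measurable (hκ.prodMk hA)

lemma measurable_trainMap (hA : Measurable A) (hκ : Measurable κ) (k : Fin K) :
    Measurable fun ω => (κ ω, A ω \ fold κ k ω) :=
  (measurable_of_finite fun x : (Fin N → Fin K) × Finset (Fin N) =>
    (x.1, x.2 \ fold id k x.1)).comp (hκ.prodMk hA)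

lemma rejectiveNorm_eq_esymm (n : ℕ) (w : Fin N → ℝ) : rejectiveNorm n w = esymm w univ n := by
  simp only [rejectiveNorm, esymm, rejSum, powersetCard_eq_filter, Nat.cast_inj, mul_one]

namespace IsRejective

lemma measureReal_preimage_singleton (hrej : IsRejective P A n w) (s : Finset (Fin N)) :
    P.real (A ⁻¹' {s}) = if (#s : ℤ) = n then (∏ i ∈ s, w i) / esymm w univ n else 0 := by
  simp only [Nat.cast_inj]
  split_ifs with hs
  · rw [← rejectiveNorm_eq_esymm]
    exact hrej.law s hs
  · rw [Measure.real, measure_eq_zero_iff_ae_notMem.2, ENNReal.toReal_zero]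
    filter_upwards [hrej.size] with ω hω h
    exact hs (Set.mem_singleton_iff.1 h ▸ hω)

lemma integral_comp [IsFiniteMeasure P] (hrej : IsRejective P A n w) (hA : Measurable A)
    (F : Finset (Fin N) → ℝ) : ∫ ω, F (A ω) ∂P = rejMean w univ n F := by
  rw [← integral_map hA.aemeasurable (measurable_of_finite F).aestronglyMeasurable,
    integral_fintype Integrable.of_finite, rejMean, rejSum, powerset_univ, sum_filter, sum_div]
  refine sum_congr rfl fun s _ => ?_
  rw [map_measureReal_apply hA (measurableSet_singleton s), hrej.measureReal_preimage_singleton,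
    smul_eq_mul]
  split_ifs
  · exact div_mul_eq_mul_div _ _ _
  · simp

lemma integral_label_sample [IsFiniteMeasure P] (hrej : IsRejective P A n w) (hA : Measurable A)
    (hκ : Measurable κ) (hind : IndepFun A κ P) (H : (Fin N → Fin K) → Finset (Fin N) → ℝ) :
    ∫ ω, H (κ ω) (A ω) ∂P = ∫ ω, rejMean w univ n (H (κ ω)) ∂P := by
  have hmeas : Measurable fun x : (Fin N → Fin K) × Finset (Fin N) => H x.1 x.2 :=
    measurable_of_finite _
  have hmap : P.map (fun ω => (κ ω, A ω)) = (P.map κ).prod (P.map A) :=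
    hind.symm.map_prod_eq_prod_map_map hκ.aemeasurable hA.aemeasurable
  calc ∫ ω, H (κ ω) (A ω) ∂P = ∫ x, H x.1 x.2 ∂(P.map fun ω => (κ ω, A ω)) :=
        (integral_map (hκ.prodMk hA).aemeasurable hmeas.aestronglyMeasurable).symm
    _ = ∫ l, ∫ s, H l s ∂(P.map A) ∂(P.map κ) := by
        rw [hmap, integral_prod _ Integrable.of_finite]
    _ = ∫ l, rejMean w univ n (H l) ∂(P.map κ) := integral_congr_ae <| .of_forall fun l =>
        (integral_map hA.aemeasurable (measurable_of_finite _).aestronglyMeasurable).trans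
          (hrej.integral_comp hA (H l))
    _ = ∫ ω, rejMean w univ n (H (κ ω)) ∂P :=
        integral_map hκ.aemeasurable (measurable_of_finite _).aestronglyMeasurable

lemma inclProb_eq_rejIncl [IsFiniteMeasure P] (hrej : IsRejective P A n w) (hA : Measurable A)
    (i : Fin N) : inclProb P A i = rejIncl w univ n i := by
  rw [rejIncl, ← hrej.integral_comp hA]
  refine (integral_indicator_one (hA (measurableSet_mem_finset i))).symm.trans
    (integral_congr_ae (.of_forall fun ω => ?_))
  simp [memInd, Set.indicator_apply]

lemma integral_mul_eq_integral_mul_rejMean_fold [IsFiniteMeasure P] (hrej : IsRejective P A n w)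
    (hA : Measurable A) (hκ : Measurable κ) (hind : IndepFun A κ P) (k : Fin K)
    (φ : (Fin N → Fin K) × Finset (Fin N) → ℝ) (H : (Fin N → Fin K) → Finset (Fin N) → ℝ) :
    ∫ ω, φ (κ ω, A ω \ fold κ k ω) * H (κ ω) (A ω) ∂P =
      ∫ ω, φ (κ ω, A ω \ fold κ k ω) * rejMean w (fold κ k ω) #(A ω ∩ fold κ k ω)
        (fun t => H (κ ω) (A ω \ fold κ k ω ∪ t)) ∂P := by
  refine (hrej.integral_label_sample hA hκ hind fun l s => φ (l, s \ fold id k l) * H l s).trans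
    (.trans ?_ (hrej.integral_label_sample hA hκ hind fun l s => φ (l, s \ fold id k l) *
      rejMean w (fold id k l) #(s ∩ fold id k l) fun t => H l (s \ fold id k l ∪ t)).symm)
  refine integral_congr_ae (.of_forall fun ω => ?_)
  refine (rejMean_eq_rejMean_rejMean (fun i => (hrej.weight_pos i).le)
    (subset_univ (fold id k (κ ω))) n _).trans (rejMean_congr fun s _ _ => ?_)
  rw [← rejMean_const_mul]
  refine rejMean_congr fun t ht _ => ?_
  rw [sdiff_union_sdiff_of_subset ht]

lemma condExp_trainField [IsFiniteMeasure P] (hrej : IsRejective P A n w) (hA : Measurable A)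
    (hκ : Measurable κ) (hind : IndepFun A κ P) (k : Fin K)
    (H : (Fin N → Fin K) → Finset (Fin N) → ℝ) :
    P[fun ω => H (κ ω) (A ω) | trainField A κ k] =ᵐ[P] fun ω =>
      rejMean w (fold κ k ω) #(A ω ∩ fold κ k ω) fun t => H (κ ω) (A ω \ fold κ k ω ∪ t) := by
  have htrain := measurable_trainMap hA hκ k
  have hint := integrable_label_sample (P := P) hA hκ fun l s =>
    rejMean w (fold id k l) #(s ∩ fold id k l) fun t => H l (s \ fold id k l ∪ t)
  refine (ae_eq_condExp_of_forall_setIntegral_eq htrain.comap_le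
    (integrable_label_sample hA hκ H) (fun _ _ _ => hint.integrableOn) ?_ ?_).symm
  · rintro _ ⟨T, hT, rfl⟩ -
    have hindicator : ∀ g : Ω → ℝ, ∫ ω in (fun ω => (κ ω, A ω \ fold κ k ω)) ⁻¹' T, g ω ∂P =
        ∫ ω, T.indicator 1 (κ ω, A ω \ fold κ k ω) * g ω ∂P := fun g => by
      rw [← integral_indicator (htrain hT)]
      refine integral_congr_ae (.of_forall fun ω => ?_)
      by_cases hω : (κ ω, A ω \ fold κ k ω) ∈ T <;> simp [hω]
    simp only [hindicator]
    exact (hrej.integral_mul_eq_integral_mul_rejMean_fold hA hκ hind k (T.indicator 1) H).symm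
  · let g : (Fin N → Fin K) × Finset (Fin N) → ℝ := fun x =>
      rejMean w (fold id k x.1) (n - #x.2) fun t => H x.1 (x.2 ∪ t)
    refine ⟨fun ω => g (κ ω, A ω \ fold κ k ω), ((measurable_of_finite g).comp
      (comap_measurable _)).stronglyMeasurable, ?_⟩
    filter_upwards [hrej.size] with ω hω
    have hcard : (n : ℤ) - #(A ω \ fold κ k ω) = #(A ω ∩ fold κ k ω) := by
      rw [← hω, ← card_sdiff_add_card_inter (A ω) (fold κ k ω)]
      push_cast
      ring
    simp only [g, hcard]
    rfl

lemma condExp_fluct_sq [IsFiniteMeasure P] (hrej : IsRejective P A n w) (hA : Measurable A)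
    (hκ : Measurable κ) (hind : IndepFun A κ P) (k : Fin K) {a : Fin N → Ω → ℝ}
    (ha : ∀ i, Measurable[trainField A κ k] (a i)) :
    P[fun ω => fluct P A κ k a ω ^ 2 | trainField A κ k] =ᵐ[P] fun ω =>
      rejMean w (fold κ k ω) #(A ω ∩ fold κ k ω) fun t => ((#(fold κ k ω) : ℝ)⁻¹ *
        ∑ i ∈ fold κ k ω, (memInd i t / inclProb P A i - 1) * a i ω) ^ 2 := by
  -- Doob–Dynkin: the array is a function of the labels and the out-of-fold sample.
  choose α _ hα using fun i => (ha i).exists_eq_measurable_comp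
  have hfold : ∀ ω, fold id k (κ ω) = fold κ k ω := fun _ => rfl
  have hαa : ∀ i ω, α i (κ ω, A ω \ fold κ k ω) = a i ω := fun i ω => (congrFun (hα i) ω).symm
  have hcond := hrej.condExp_trainField hA hκ hind k fun l s => ((#(fold id k l) : ℝ)⁻¹ *
    ∑ i ∈ fold id k l, (memInd i s / inclProb P A i - 1) * α i (l, s \ fold id k l)) ^ 2
  simp only [hfold, hαa] at hcond
  refine hcond.trans (.of_forall fun ω => rejMean_congr fun t ht _ => ?_)
  rw [sdiff_union_sdiff_of_subset ht]
  exact congrArg (fun x => (_ * x) ^ 2) (sum_congr rfl fun i hi => by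
    rw [memInd_sdiff_union hi, hαa])

end IsRejective

/-- The deviation of the number of sampled units in the fold from its conditional mean given the
labels. -/
def foldCountDev (P : Measure Ω) (A : Ω → Finset (Fin N)) (κ : Ω → Fin N → Fin K) (k : Fin K)
    (ω : Ω) : ℝ :=
  #(A ω ∩ fold κ k ω) - ∑ i ∈ fold κ k ω, inclProb P A i

/-- The constant of the conditional fluctuation bound when inclusion probabilities lie in
`[p, q]`, the fold has at least `c N` units and its sample size is within `τ √N_k` of its mean. -/
def fluctConst (p q c τ : ℝ) : ℝ :=
  2 * (2 + ((p * (1 - q))⁻¹ * (τ + 1)) ^ 2) / p ^ 2 / c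

variable [IsProbabilityMeasure P]

namespace IsRejective

lemma size_le (hrej : IsRejective P A n w) : n ≤ N := by
  obtain ⟨ω, hω⟩ := hrej.size.exists
  rw [← hω]
  exact card_finset_fin_le (A ω)

lemma esymm_pos (hrej : IsRejective P A n w) : 0 < esymm w univ n :=
  SurveySampling.esymm_pos hrej.weight_pos (hrej.size_le.trans_eq (card_fin N).symm)

lemma size_pos (hrej : IsRejective P A n w) (hA : Measurable A) (hN : 0 < N) {p : ℝ} (hp : 0 < p)
    (hπ : ∀ i, p ≤ inclProb P A i) : 0 < n := by
  have : Nonempty (Fin N) := ⟨⟨0, hN⟩⟩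
  have hsum : ∑ i, inclProb P A i = n := by
    simp only [hrej.inclProb_eq_rejIncl hA]
    exact mod_cast sum_rejIncl hrej.esymm_pos
  have hpos : (0 : ℝ) < n := hsum ▸ sum_pos (fun i _ => hp.trans_le (hπ i)) univ_nonempty
  exact mod_cast hpos

lemma weight_le_mul_weight (hrej : IsRejective P A n w) (hA : Measurable A) {p q : ℝ}
    (hp : 0 < p) (hq : q < 1) (hπ : ∀ i, p ≤ inclProb P A i ∧ inclProb P A i ≤ q) (i j : Fin N) :
    w i ≤ (p * (1 - q))⁻¹ * w j := by
  have hpq : 0 < p * (1 - q) := mul_pos hp (sub_pos.2 hq)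
  rw [le_inv_mul_iff₀ hpq]
  refine le_trans ?_ (rejIncl_mul_one_sub_rejIncl_mul_le (fun i => (hrej.weight_pos i).le)
    hrej.esymm_pos (mem_univ i) (mem_univ j))
  rw [← hrej.inclProb_eq_rejIncl hA, ← hrej.inclProb_eq_rejIncl hA]
  have := (hπ j).1
  have := (hπ i).2
  have := (hrej.weight_pos i).le
  gcongr
  exact hp.le.trans (hπ j).1

lemma integral_foldCountDev_sq_div_card_le (hrej : IsRejective P A n w) (hA : Measurable A)
    (hκ : Measurable κ) (hind : IndepFun A κ P) (k : Fin K) :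
    ∫ ω, foldCountDev P A κ k ω ^ 2 / #(fold κ k ω) ∂P ≤ 1 := by
  refine (hrej.integral_label_sample hA hκ hind fun l s =>
    (#(s ∩ fold id k l) - ∑ i ∈ fold id k l, inclProb P A i) ^ 2 / #(fold id k l)).trans_le ?_
  have hmean : ∀ U : Finset (Fin N), rejMean w univ n
      (fun s => (#(s ∩ U) - ∑ i ∈ U, inclProb P A i) ^ 2 / #U) ≤ 1 := fun U => by
    simp only [hrej.inclProb_eq_rejIncl hA, div_eq_inv_mul, rejMean_const_mul]
    rw [← div_eq_inv_mul]
    exact div_le_one_of_le₀ (rejMean_sq_card_inter_sub_le (fun i => (hrej.weight_pos i).le)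
      hrej.esymm_pos (subset_univ U)) (Nat.cast_nonneg _)
  calc _ ≤ ∫ _, (1 : ℝ) ∂P := integral_mono (integrable_label_sample hA hκ fun l _ =>
        rejMean w univ n fun s => (#(s ∩ fold id k l) - ∑ i ∈ fold id k l, inclProb P A i) ^ 2 /
          #(fold id k l)) (integrable_const 1) fun ω => hmean _
    _ = 1 := by simp

lemma measureReal_lt_abs_foldCountDev_le (hrej : IsRejective P A n w) (hA : Measurable A)
    (hκ : Measurable κ) (hind : IndepFun A κ P) {τ : ℝ} (hτ : 0 < τ) (k : Fin K) :
    P.real {ω | τ * √(#(fold κ k ω)) < |foldCountDev P A κ k ω|} ≤ 1 / τ ^ 2 := by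
  have hmarkov : τ ^ 2 * P.real {ω | τ ^ 2 ≤ foldCountDev P A κ k ω ^ 2 / #(fold κ k ω)} ≤ 1 :=
    (mul_meas_ge_le_integral_of_nonneg (.of_forall fun ω => by positivity)
      (integrable_label_sample hA hκ fun l s => (#(s ∩ fold id k l) -
        ∑ i ∈ fold id k l, inclProb P A i) ^ 2 / #(fold id k l)) (τ ^ 2)).trans
      (hrej.integral_foldCountDev_sq_div_card_le hA hκ hind k)
  rw [le_div_iff₀' (by positivity)]
  refine (mul_le_mul_of_nonneg_left (measureReal_mono fun ω hω => ?_) (sq_nonneg τ)).trans hmarkov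
  rw [Set.mem_ofPred_eq] at hω ⊢
  have hcard : (0 : ℝ) < #(fold κ k ω) := by
    rw [Nat.cast_pos, card_pos, nonempty_iff_ne_empty]
    intro h0
    simp [foldCountDev, h0] at hω
  rw [le_div_iff₀ hcard, ← sq_abs (foldCountDev _ _ _ _ _), ← Real.sq_sqrt hcard.le, ← mul_pow]
  exact pow_le_pow_left₀ (by positivity) hω.le 2

lemma condExp_fluct_sq_le (hrej : IsRejective P A n w) (hA : Measurable A) (hκ : Measurable κ)
    (hind : IndepFun A κ P) {p q c τ : ℝ} (hp : 0 < p) (hq : q < 1)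
    (hπ : ∀ i, p ≤ inclProb P A i ∧ inclProb P A i ≤ q) (hc : 0 < c) (hn : 0 < n)
    (k : Fin K) {a : Fin N → Ω → ℝ} (ha : ∀ i, Measurable[trainField A κ k] (a i)) :
    ∀ᵐ ω ∂P, c * N ≤ #(fold κ k ω) → |foldCountDev P A κ k ω| ≤ τ * √(#(fold κ k ω)) →
      (P[fun ω' => fluct P A κ k a ω' ^ 2 | trainField A κ k]) ω ≤
        fluctConst p q c τ / n * foldMeanSq κ k a ω := by
  filter_upwards [hrej.condExp_fluct_sq hA hκ hind k ha] with ω hω hcard hdev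
  rw [hω]
  set U := fold κ k ω
  have hw := fun i => (hrej.weight_pos i).le
  have hcount : #(A ω ∩ U) ≤ #U := card_le_card inter_subset_right
  have hbias : ∀ i ∈ U, |rejIncl w U #(A ω ∩ U) i - inclProb P A i| ≤
      (p * (1 - q))⁻¹ * (τ + 1) / √(#U) := fun i hi => by
    simp only [foldCountDev, hrej.inclProb_eq_rejIncl hA] at hdev ⊢
    exact abs_rejIncl_sub_rejIncl_le hrej.weight_pos (subset_univ U) hrej.esymm_pos
      (fun i _ j _ => hrej.weight_le_mul_weight hA hp hq hπ i j) hcount hdev hi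
  refine (rejMean_sq_mean_div_sub_one_le hw (SurveySampling.esymm_pos hrej.weight_pos hcount) hp
    (fun i _ => (hπ i).1) hbias fun i => a i ω).trans ?_
  refine mul_le_mul_of_nonneg_right ?_ (by positivity)
  have hcn : c * n ≤ #U := le_trans (by gcongr; exact hrej.size_le) hcard
  rw [fluctConst, div_div _ c]
  gcongr

/-- `#S` does not enter the bound because at most `1 / c` folds can have `c N` units each. -/
lemma measureReal_forall_le_card_fold_le (hrej : IsRejective P A n w) (hA : Measurable A)
    (hκ : Measurable κ) (hind : IndepFun A κ P) {c τ : ℝ} (hc : 0 < c) (hτ : 0 < τ) (hN : 0 < N)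
    (S : Finset (Fin K)) :
    P.real {ω | ∀ k ∈ S, c * N ≤ #(fold κ k ω)} ≤
      P.real {ω | ∀ k ∈ S, c * N ≤ #(fold κ k ω) ∧
        |foldCountDev P A κ k ω| ≤ τ * √(#(fold κ k ω))} + 1 / (c * τ ^ 2) := by
  obtain hempty | ⟨ω₀, hω₀⟩ := Set.eq_empty_or_nonempty {ω | ∀ k ∈ S, c * N ≤ #(fold κ k ω)}
  · rw [hempty, measureReal_empty]
    positivity
  have hS : (#S : ℝ) ≤ 1 / c := by
    have hcN := card_mul_le_of_forall_le_card_fold hω₀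
    have hN' : (0 : ℝ) < N := mod_cast hN
    rw [le_div_iff₀ hc]
    exact le_of_mul_le_mul_right (by linarith) hN'
  set bad : Fin K → Set Ω := fun k => {ω | τ * √(#(fold κ k ω)) < |foldCountDev P A κ k ω|}
  have hbad : P.real (⋃ k ∈ S, bad k) ≤ 1 / (c * τ ^ 2) :=
    calc P.real (⋃ k ∈ S, bad k) ≤ ∑ k ∈ S, P.real (bad k) := measureReal_biUnion_finset_le S bad
      _ ≤ #S • (1 / τ ^ 2) := sum_le_card_nsmul S _ _ fun k _ =>
          hrej.measureReal_lt_abs_foldCountDev_le hA hκ hind hτ k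
      _ ≤ 1 / c * (1 / τ ^ 2) := by rw [nsmul_eq_mul]; gcongr
      _ = 1 / (c * τ ^ 2) := one_div_mul_one_div c (τ ^ 2)
  refine (measureReal_mono fun ω hω => ?_).trans
    ((measureReal_union_le _ _).trans (add_le_add_right hbad _))
  by_cases hmem : ω ∈ ⋃ k ∈ S, bad k
  · exact .inr hmem
  · simp only [bad, Set.mem_iUnion, Set.mem_ofPred_eq, not_exists, not_lt] at hmem
    exact .inl fun k hk => ⟨hω k hk, hmem k hk⟩

theorem exists_measurableSet_condExp_fluct_sq_le (hrej : IsRejective P A n w) (hA : Measurable A)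
    (hκ : Measurable κ) (hind : IndepFun A κ P) {p q c η : ℝ} (hp : 0 < p) (hq : q < 1)
    (hπ : ∀ i, p ≤ inclProb P A i ∧ inclProb P A i ≤ q) (hc : 0 < c) (hη : 0 < η) (hN : 0 < N)
    {S : Finset (Fin K)} (hS : 1 - η / 2 ≤ P.real {ω | ∀ k ∈ S, c * N ≤ #(fold κ k ω)}) :
    ∃ E : Set Ω, MeasurableSet E ∧ 1 - η ≤ P.real E ∧ ∀ k ∈ S, ∀ a : Fin N → Ω → ℝ,
      (∀ i, Measurable[trainField A κ k] (a i)) → ∀ᵐ ω ∂P, ω ∈ E →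
        (P[fun ω' => fluct P A κ k a ω' ^ 2 | trainField A κ k]) ω ≤
          fluctConst p q c √(2 / (c * η)) / n * foldMeanSq κ k a ω := by
  set τ := √(2 / (c * η))
  have hτ : 0 < τ := Real.sqrt_pos.2 (by positivity)
  have hτη : 1 / (c * τ ^ 2) = η / 2 := by
    rw [Real.sq_sqrt (by positivity)]
    field_simp
  refine ⟨{ω | ∀ k ∈ S, c * N ≤ #(fold κ k ω) ∧
    |foldCountDev P A κ k ω| ≤ τ * √(#(fold κ k ω))}, ?_, ?_, fun k hk a ha => ?_⟩
  · exact measurableSet_of_label_sample hA hκ fun l s => ∀ k ∈ S, c * N ≤ #(fold id k l) ∧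
      |#(s ∩ fold id k l) - ∑ i ∈ fold id k l, inclProb P A i| ≤ τ * √(#(fold id k l))
  · linarith [hrej.measureReal_forall_le_card_fold_le hA hκ hind hc hτ hN S]
  · have hn := hrej.size_pos hA hN hp fun i => (hπ i).1
    filter_upwards [hrej.condExp_fluct_sq_le hA hκ hind hp hq hπ hc hn k ha] with ω hω hE
    exact hω (hE k hk).1 (hE k hk).2

end IsRejective

end Design

end SurveySampling

end

theorem proposition3_general {Ω : ℕ → Type*} [∀ N, MeasurableSpace (Ω N)]
    (P : ∀ N, Measure (Ω N)) [∀ N, IsProbabilityMeasure (P N)]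
    (n K : ℕ → ℕ)
    (A : ∀ N, Ω N → Finset (Fin N)) (κ : ∀ N, Ω N → Fin N → Fin (K N))
    (hA : ∀ N, Measurable (A N)) (hκ : ∀ N, Measurable (κ N))
    (hind : ∀ N, IndepFun (A N) (κ N) (P N))
    (w : ∀ N, Fin N → ℝ)
    (hrej : ∀ N, SurveySampling.IsRejective (P N) (A N) (n N) (w N))
    (πmin πmax : ℝ) (hmin : 0 < πmin) (hmax : πmax < 1)
    (hπ : ∀ᶠ N in atTop, ∀ i : Fin N,
      πmin ≤ SurveySampling.inclProb (P N) (A N) i ∧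
        SurveySampling.inclProb (P N) (A N) i ≤ πmax) :
    (∀ k : ∀ N, Fin (K N), SurveySampling.BalancedFold P κ k →
      ∀ η : ℝ, 0 < η → ∃ Cη : ℝ, ∃ Nη : ℕ, ∀ N ≥ Nη,
        ∀ a : Fin N → Ω N → ℝ,
          (∀ i, Measurable[SurveySampling.trainField (A N) (κ N) (k N)] (a i)) →
          1 - η ≤ (P N).real {ω |
            ((P N)[fun ω' => SurveySampling.fluct (P N) (A N) (κ N) (k N) a ω' ^ 2 |
              SurveySampling.trainField (A N) (κ N) (k N)]) ω
              ≤ Cη / n N * SurveySampling.foldMeanSq (κ N) (k N) a ω}) ∧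
    (SurveySampling.BalancedFolds P κ →
      SurveySampling.FoldwiseFluctuationBound P A κ n) := by
  refine ⟨?_, ?_⟩
  · rintro k ⟨c, C, hc, -, hbal⟩ η hη
    obtain ⟨Nη, hNη⟩ := eventually_atTop.1 <| (hπ.and (eventually_gt_atTop 0)).and
      (hbal.eventually_const_le (sub_lt_self 1 (half_pos hη)))
    refine ⟨SurveySampling.fluctConst πmin πmax c √(2 / (c * η)), Nη, fun N hN a ha => ?_⟩
    obtain ⟨⟨hπN, hpos⟩, hbalN⟩ := hNη N hN
    obtain ⟨E, -, hPE, hE⟩ := (hrej N).exists_measurableSet_condExp_fluct_sq_le (hA N) (hκ N)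
      (hind N) hmin hmax hπN hc hη hpos (S := {k N}) <| hbalN.trans <|
        measureReal_mono fun ω hω j hj => Finset.mem_singleton.1 hj ▸ hω.1
    exact hPE.trans <| ENNReal.toReal_mono (measure_ne_top _ _) <|
      measure_mono_ae (hE (k N) (Finset.mem_singleton_self _) a ha)
  · rintro ⟨c, C, hc, -, hbal⟩ η hη -
    obtain ⟨Nη, hNη⟩ := eventually_atTop.1 <| (hπ.and (eventually_gt_atTop 0)).and
      (hbal.eventually_const_le (sub_lt_self 1 (half_pos hη)))
    refine ⟨SurveySampling.fluctConst πmin πmax c √(2 / (c * η)), Nη, fun N hN => ?_⟩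
    obtain ⟨⟨hπN, hpos⟩, hbalN⟩ := hNη N hN
    obtain ⟨E, hEmeas, hPE, hE⟩ := (hrej N).exists_measurableSet_condExp_fluct_sq_le (hA N) (hκ N)
      (hind N) hmin hmax hπN hc hη hpos (S := Finset.univ) <| hbalN.trans <|
        measureReal_mono fun ω hω k _ => (hω k).1
    exact ⟨E, hEmeas, hPE, fun k => hE k (Finset.mem_univ k)⟩

theorem proposition3 {Ω : ℕ → Type*} [∀ N, MeasurableSpace (Ω N)]
    (P : ∀ N, Measure (Ω N)) [∀ N, IsProbabilityMeasure (P N)]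
    (n K : ℕ → ℕ)
    (A : ∀ N, Ω N → Finset (Fin N)) (κ : ∀ N, Ω N → Fin N → Fin (K N))
    (hA : ∀ N, Measurable (A N)) (hκ : ∀ N, Measurable (κ N))
    (hind : ∀ N, IndepFun (A N) (κ N) (P N))
    (w : ∀ N, Fin N → ℝ)
    (hrej : ∀ N, SurveySampling.IsRejective (P N) (A N) (n N) (w N))
    (πmin πmax : ℝ) (hmin : 0 < πmin) (hmax : πmax < 1)
    (hπ : ∀ᶠ N in atTop, ∀ i : Fin N,
      πmin ≤ SurveySampling.inclProb (P N) (A N) i ∧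
        SurveySampling.inclProb (P N) (A N) i ≤ πmax)
    (f : ℝ) (hf0 : 0 < f) (hf1 : f < 1)
    (hf : Tendsto (fun N : ℕ => (n N : ℝ) / N) atTop (𝓝 f)) :
    (∀ k : ∀ N, Fin (K N), SurveySampling.BalancedFold P κ k →
      ∀ η : ℝ, 0 < η → ∃ Cη : ℝ, ∃ Nη : ℕ, ∀ N ≥ Nη,
        ∀ a : Fin N → Ω N → ℝ,
          (∀ i, Measurable[SurveySampling.trainField (A N) (κ N) (k N)] (a i)) →
          1 - η ≤ (P N).real {ω |
            ((P N)[fun ω' => SurveySampling.fluct (P N) (A N) (κ N) (k N) a ω' ^ 2 |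
              SurveySampling.trainField (A N) (κ N) (k N)]) ω
              ≤ Cη / n N * SurveySampling.foldMeanSq (κ N) (k N) a ω}) ∧
    (SurveySampling.BalancedFolds P κ →
      SurveySampling.FoldwiseFluctuationBound P A κ n) := by
  exact proposition3_general P n K A κ hA hκ hind w hrej πmin πmax hmin hmax hπ
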